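/- Let $G=\mathrm{Sym}(\mathbb N)$ be the group of all permutations of $\mathbb N$. For a set $X$ with an action of $G$, a set $D\subseteq\mathbb N$ supports $x\in X$ if $\pi\cdot x=x$ for every $\pi\in G$ that fixes every element of $D$. The least support $\mathrm{supp}(x)$ is the unique finite set that supports $x$ and has no proper subset supporting $x$, if exactly one such set exists. $X$ is a nominal set if every element of $X$ has a least support; its nominal dimension is $\sup_{x\in X}|\mathrm{supp}(x)|$, and it is orbit-finite if it has finitely many $G$-orbits. Let $A$ be an orbit-finite nominal set. A nominal DFA over $A$ consists of an orbit-finite nominal set $Q$ of states, an equivariant transition function $\delta:Q\times A\to Q$, an initial state $q_0\in Q$ whose orbit is $\{q_0\}$, and an equivariant set $F\subseteq Q$ of accepting states; it recognizes the language $L:A^*\to\{0,1\}$ with $L(w)=1$ if and only if the run on $w$ ends in $F$. A $G$-language is a function $L:A^*\to\{0,1\}$ such that $\{w : L(w)=1\}$ is invariant under the letterwise action of $G$. For natural numbers $n,k$, let $\mathcal L^{\mathrm{nom}}_A(n,k)$ be the class of $G$-languages over $A$ recognized by a nominal DFA whose state set has at most $n$ orbits and nominal dimension at most $k$. The Littlestone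 dimension $\mathrm{Ldim}(\mathcal C)$ of a class $\mathcal C$ of functions $X\to\{0,1\}$ is the maximal $d$ for which there is a complete binary tree of height $d$, with internal nodes labeled by elements of $X$, that is shattered by $\mathcal C$ (and $\infty$ if there is no maximal $d$). Shattered means that the leaves can be labeled by elements of $\mathcal C$ in such a way that, for every leaf with label $c$ and every internal node above it with label $x$, $c(x)=1$ if and only if the path from the root to the leaf goes through the left child of that node. Then for every orbit-finite nominal set $A$ of nominal dimension $p$ there is a constant $C>0$, depending only on $A$, such that for all integers $n\ge 1$ and $k\ge 1$ with $(n,k)\neq(1,1)$, $$\mathrm{Ldim}\bigl(\mathcal L^{\mathrm{nom}}_A(n,k)\bigr)\;\le\; C\,n\,k^{p}\,(\log n+k\log k).$$ In particular, this Littlestone dimension is finite. -/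

import Mathlib

/-! Nominal sets (for the equality symmetry), nominal automata, Littlestone dimension. -/

universe u v

namespace Nominal

open MulAction

/-- The group of all permutations of the atoms `ℕ`. -/
abbrev G : Type := Equiv.Perm ℕ

section Sets

variable {X : Type u} [MulAction G X]

/-- `D` is a finite support of `x` none of whose proper subsets supports `x`. Here
`Supports G D x` says that every permutation fixing each element of `D` fixes `x`. -/
def IsMinimalSupport (D : Finset ℕ) (x : X) : Prop :=
  Supports G (D : Set ℕ) x ∧ ∀ E : Set ℕ, E ⊂ (D : Set ℕ) → ¬ Supports G E x

/-- `D` is the least support of `x`: it is the one and only finite minimal support of `x`. -/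
def IsLeastSupport (D : Finset ℕ) (x : X) : Prop :=
  IsMinimalSupport D x ∧ ∀ E : Finset ℕ, IsMinimalSupport E x → E = D

end Sets

/-- A set with an action of `G` is a nominal set if each of its elements has a least support. -/
class IsNominal (X : Type u) [MulAction G X] : Prop where
  exists_isLeastSupport : ∀ x : X, ∃ D : Finset ℕ, IsLeastSupport D x

/-- The least support of an element of a nominal set. -/
noncomputable def supp {X : Type u} [MulAction G X] [IsNominal X] (x : X) : Finset ℕ :=
  Classical.choose (IsNominal.exists_isLeastSupport x)

/-- The nominal dimension: the supremum of the sizes of the least supports. -/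
noncomputable def nominalDim (X : Type u) [MulAction G X] [IsNominal X] : ℕ∞ :=
  ⨆ x : X, ((supp x).card : ℕ∞)

/-- The number of orbits (`⊤` if there are infinitely many). -/
noncomputable def numOrbits (X : Type u) [MulAction G X] : ℕ∞ :=
  ENat.card (orbitRel.Quotient G X)

/-- `X` is the union of finitely many orbits. -/
def OrbitFinite (X : Type u) [MulAction G X] : Prop :=
  Finite (orbitRel.Quotient G X)

/-- A `G`-language over `A`: a function `A^* → {0,1}` whose set of ones is equivariant, where `G`
acts on strings letter by letter. -/
def IsGLanguage {A : Type u} [MulAction G A] (L : List A → Bool) : Prop :=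
  ∀ (π : G) (w : List A), L w = true → L (w.map (fun a => π • a)) = true

/-- A nominal DFA over `A` with state set `Q`. The underlying `DFA` carries the transition function
`step`, the initial state `start` and the set `accept` of accepting states (and no finiteness
condition). -/
structure NominalDFA (A : Type u) [MulAction G A] (Q : Type v) [MulAction G Q] [IsNominal Q]
    extends DFA A Q where
  orbitFinite : OrbitFinite Q
  step_equivariant : ∀ (π : G) (q : Q) (a : A), step (π • q) (π • a) = π • step q a
  orbit_start : orbit G start = {start}
  accept_equivariant : ∀ (π : G) (q : Q), q ∈ accept → π • q ∈ accept

/-- `M` recognizes `L`: it accepts exactly the strings `w` with `L w = 1`. -/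
def NominalDFA.Recognizes {A : Type u} [MulAction G A] {Q : Type v} [MulAction G Q] [IsNominal Q]
    (M : NominalDFA A Q) (L : List A → Bool) : Prop :=
  ∀ w : List A, M.toDFA.eval w ∈ M.accept ↔ L w = true

/-- The class of `G`-languages over `A` that are recognized by some nominal DFA with at most `n`
orbits and nominal dimension at most `k`. -/
def nominalLanguages (A : Type u) [MulAction G A] (n k : ℕ) : Set (List A → Bool) :=
  {L | IsGLanguage L ∧
    ∃ (Q : Type v) (_ : MulAction G Q) (_ : IsNominal Q) (M : NominalDFA A Q),
      numOrbits Q ≤ n ∧ nominalDim Q ≤ k ∧ M.Recognizes L}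

section Littlestone

/-- A complete binary tree of height `d` with internal nodes labeled by elements of `X`. An internal
node at depth `i < d` is the sequence of the `i` turns leading to it from the root
(`true` is left, `false` is right). -/
abbrev BinaryElementTree (X : Type u) (d : ℕ) : Type u :=
  (i : Fin d) → (Fin i → Bool) → X

/-- `T` is shattered by `C`: the leaves, i.e. the sequences of `d` turns, can be labeled by elements
of `C` such that the label of a leaf `s` takes the value `1` at the label of an internal node above
`s` if and only if the path from the root to `s` turns left at that node. -/
def Shatters {X : Type u} {d : ℕ} (C : Set (X → Bool)) (T : BinaryElementTree X d) : Prop :=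
  ∃ leafLabel : (Fin d → Bool) → (X → Bool),
    (∀ s, leafLabel s ∈ C) ∧
    ∀ (s : Fin d → Bool) (i : Fin d),
      leafLabel s (T i (fun j => s (Fin.castLE i.isLt.le j))) = true ↔ s i = true

/-- The Littlestone dimension: the largest height of a binary element tree shattered by `C`,
and `⊤` if there is no largest one. -/
noncomputable def littlestoneDim {X : Type u} (C : Set (X → Bool)) : ℕ∞ :=
  ⨆ d ∈ {d : ℕ | ∃ T : BinaryElementTree X d, Shatters C T}, (d : ℕ∞)

end Littlestone

end Nominal

/-!
A nominal set with finitely many orbits, of nominal dimension at most `m`, is generated under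
permutations of the atoms by finitely many elements supported by the atoms below `m`. Choosing such
generators for the states of a nominal DFA (dimension `k`) turns it into a register automaton: the
state `π • q i` is the control state `i` together with the contents `π 0, …, π (k - 1)` of `k`
registers. A letter of an alphabet of dimension `p` can, by a permutation fixing the registers, be
brought to one supported by the atoms below `k + p`, so that finitely many transitions describe
the whole automaton, and the recognized language depends only on these finitely many data. Hence
there are at most `2 ^ O(n k ^ p (log n + k log k))` languages, and a finite class has Littlestone
dimension at most the binary logarithm of its size.
-/

namespace Nominal

open MulAction

section Permutations

variable {α : Type*}

theorem exists_perm_eqOn {s : Finset α} {f : α → α} (hf : Set.InjOn f s) :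
    ∃ π : Equiv.Perm α, Set.EqOn π f s := by
  have := Equiv.Perm.isMultiplyPretransitive α s.card
  let e : Fin s.card ↪ α := s.equivFin.symm.toEmbedding.trans (.subtype _)
  let e' : Fin s.card ↪ α :=
    ⟨fun i => f (e i), fun i j hij => e.injective <|
      hf (s.equivFin.symm i).2 (s.equivFin.symm j).2 hij⟩
  obtain ⟨π, hπ⟩ := exists_smul_eq (Equiv.Perm α) e e'
  refine ⟨π, fun a ha => ?_⟩
  have := DFunLike.congr_fun hπ (s.equivFin ⟨a, ha⟩)
  simpa [e, e', Function.Embedding.coeFn_mk] using this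

theorem exists_perm_eqOn_mapsTo [DecidableEq α] {s t u : Finset α} {f : α → α}
    (hf : Set.InjOn f s) (hfu : Set.MapsTo f s u) (hcard : (s ∪ t).card ≤ u.card) :
    ∃ π : Equiv.Perm α, Set.EqOn π f s ∧ Set.MapsTo π t u := by
  obtain ⟨v, hsv, hvu, hv⟩ := Finset.exists_subsuperset_card_eq
    (Finset.image_subset_iff.2 hfu)
    ((Finset.card_image_le.trans (Finset.card_le_card Finset.subset_union_left))) hcard
  obtain ⟨e, he⟩ := Set.MapsTo.exists_equiv_extend_of_card_eq (α := ↥(s ∪ t)) (t := v)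
    (by simp [hv]) (s := {a | (a : α) ∈ s}) (f := fun a => f a)
    (fun a ha => hsv (Finset.mem_image_of_mem f ha))
    (fun a ha b hb hab => Subtype.ext (hf ha hb hab))
  let g : α → α := fun a => if h : a ∈ s ∪ t then e ⟨a, h⟩ else a
  have hg : ∀ a (h : a ∈ s ∪ t), g a = e ⟨a, h⟩ := fun a h => dif_pos h
  obtain ⟨π, hπ⟩ := exists_perm_eqOn (s := s ∪ t) (f := g) fun a ha b hb hab => by
    rw [hg a ha, hg b hb] at hab
    exact congrArg Subtype.val (e.injective (Subtype.ext hab))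
  refine ⟨π, fun a ha => ?_, fun a ha => ?_⟩
  · have ha' := Finset.mem_union_left t ha
    rw [hπ ha', hg a ha']
    exact he ⟨a, ha'⟩ ha
  · have ha' := Finset.mem_union_right s ha
    rw [hπ ha', hg a ha']
    exact hvu (e ⟨a, ha'⟩).2

/-- A permutation of the atoms that extends the embedding `f` of the atoms below `k` into those
below `m`. -/
noncomputable def extend {k m : ℕ} (f : Fin k ↪ Fin m) : G :=
  have := Equiv.Perm.isMultiplyPretransitive ℕ k
  Classical.choose (exists_smul_eq G Fin.valEmbedding (f.trans Fin.valEmbedding))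

theorem extend_apply {k m : ℕ} (f : Fin k ↪ Fin m) (a : Fin k) : extend f a = f a := by
  have := Equiv.Perm.isMultiplyPretransitive ℕ k
  exact DFunLike.congr_fun
    (Classical.choose_spec (exists_smul_eq G Fin.valEmbedding (f.trans Fin.valEmbedding))) a

theorem exists_eqOn_extend {k m : ℕ} {π : G} (hπ : Set.MapsTo π (Set.Iio k) (Set.Iio m)) :
    ∃ f : Fin k ↪ Fin m, Set.EqOn (extend f) π (Set.Iio k) := by
  let f : Fin k ↪ Fin m :=
    ⟨fun a => ⟨π a, hπ a.2⟩, fun a b hab => Fin.ext (π.injective (Fin.ext_iff.1 hab))⟩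
  exact ⟨f, fun a ha => extend_apply f ⟨a, ha⟩⟩

theorem mapsTo_extend {k m : ℕ} (f : Fin k ↪ Fin m) :
    Set.MapsTo (extend f) (Set.Iio k) (Set.Iio m) := fun a ha => by
  rw [extend_apply f ⟨a, ha⟩]
  exact (f ⟨a, ha⟩).2

end Permutations

section Supports

variable {X : Type*} [MulAction G X]

theorem smul_eq_smul_of_supports {s : Set ℕ} {x : X} (hs : Supports G s x) {π σ : G}
    (h : Set.EqOn π σ s) : π • x = σ • x := by
  have := hs (σ⁻¹ * π) fun a ha => by simp [Equiv.Perm.smul_def, h ha]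
  rwa [mul_smul, inv_smul_eq_iff] at this

theorem supports_image_smul {s : Set ℕ} {x : X} (hs : Supports G s x) (π : G) :
    Supports G (π '' s) (π • x) := by
  intro σ hσ
  rw [← mul_smul]
  exact smul_eq_smul_of_supports hs fun a ha => hσ (Set.mem_image_of_mem π ha)

theorem IsLeastSupport.subset {D E : Finset ℕ} {x : X} (hD : IsLeastSupport D x)
    (hE : Supports G (E : Set ℕ) x) : D ⊆ E := by
  induction E using Finset.strongInduction with
  | H E ih =>
    by_cases hmin : IsMinimalSupport E x
    · exact (hD.2 E hmin).symm.subset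
    · obtain ⟨F, hFE, hF⟩ : ∃ F : Set ℕ, F ⊂ (E : Set ℕ) ∧ Supports G F x := by
        simpa only [IsMinimalSupport, hE, true_and, not_forall, not_not, exists_prop] using hmin
      lift F to Finset ℕ using E.finite_toSet.subset hFE.subset
      rw [Finset.coe_ssubset] at hFE
      exact (ih F hFE hF).trans hFE.subset

variable [IsNominal X]

theorem isLeastSupport_supp (x : X) : IsLeastSupport (supp x) x :=
  Classical.choose_spec (IsNominal.exists_isLeastSupport x)

theorem supports_supp (x : X) : Supports G (supp x : Set ℕ) x :=
  (isLeastSupport_supp x).1.1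

theorem supp_subset {E : Finset ℕ} {x : X} (hE : Supports G (E : Set ℕ) x) : supp x ⊆ E :=
  (isLeastSupport_supp x).subset hE

theorem card_supp_le {m : ℕ} (h : nominalDim X ≤ m) (x : X) : (supp x).card ≤ m := by
  exact_mod_cast (le_iSup (fun x : X => ((supp x).card : ℕ∞)) x).trans h

theorem exists_supports_Iio_smul {m : ℕ} {x : X} (h : (supp x).card ≤ m) :
    ∃ π : G, Supports G (Set.Iio m) (π • x) := by
  obtain ⟨π, -, hπ⟩ := exists_perm_eqOn_mapsTo (s := ∅) (t := supp x) (u := Finset.range m)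
    (f := id) (by simp) (by simp [Set.MapsTo]) (by simpa using h)
  refine ⟨π, (supports_image_smul (supports_supp x) π).mono ?_⟩
  simpa using hπ.image_subset

end Supports

section Generators

variable {X : Type*} [MulAction G X] {ι κ : Type*}

/-- The elements `x i` are supported by the atoms below `m` and meet every orbit of the group of
permutations that fix the atoms below `k`. For `k = 0` these are the orbits of `G`; a positive `k`
describes letters relative to the contents of `k` registers. -/
structure GeneratesOver (k m : ℕ) (x : ι → X) : Prop where
  supports : ∀ i, Supports G (Set.Iio m) (x i)
  exists_smul_eq : ∀ y, ∃ i, ∃ θ ∈ fixingSubgroup G (Set.Iio k), θ • x i = y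

theorem GeneratesOver.comp_surjective {k m : ℕ} {x : ι → X} (hx : GeneratesOver k m x) {e : κ → ι}
    (he : Function.Surjective e) : GeneratesOver k m (x ∘ e) where
  supports i := hx.supports (e i)
  exists_smul_eq y := by
    obtain ⟨i, hi⟩ := hx.exists_smul_eq y
    obtain ⟨j, rfl⟩ := he i
    exact ⟨j, hi⟩

/-- A permutation fixing the atoms below `k` can move the atoms `ρ 0, …, ρ (p - 1)`, which support
`ρ • x i`, below `k + p`. -/
theorem GeneratesOver.extend_smul {p : ℕ} {x : ι → X} (hx : GeneratesOver 0 p x) (k : ℕ) :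
    GeneratesOver k (k + p) fun b : ι × (Fin p ↪ Fin (k + p)) => extend b.2 • x b.1 where
  supports b := (supports_image_smul (hx.supports b.1) _).mono (mapsTo_extend b.2).image_subset
  exists_smul_eq y := by
    obtain ⟨i, ρ, -, rfl⟩ := hx.exists_smul_eq y
    obtain ⟨θ, hθ, hmaps⟩ := exists_perm_eqOn_mapsTo (s := Finset.range k)
      (t := (Finset.range p).image ρ) (u := Finset.range (k + p)) (f := id)
      (Set.injOn_id _) (by simp +contextual [Set.MapsTo, Nat.lt_add_right])
      ((Finset.card_union_le _ _).trans (by simp [Finset.card_image_of_injective _ ρ.injective]))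
    obtain ⟨f, hf⟩ := exists_eqOn_extend (k := p) (m := k + p) (π := θ * ρ) fun a ha => by
      simpa using hmaps (Finset.mem_coe.2 (Finset.mem_image_of_mem ρ (Finset.mem_range.2 ha)))
    refine ⟨(i, f), θ⁻¹, inv_mem ?_, ?_⟩
    · exact (mem_fixingSubgroup_iff G).2 fun a ha => hθ (by simpa using ha)
    · rw [inv_smul_eq_iff, smul_smul]
      exact smul_eq_smul_of_supports (hx.supports i) hf

variable [IsNominal X]

theorem exists_generatesOver {m : ℕ} (h : nominalDim X ≤ m) :
    ∃ x : orbitRel.Quotient G X → X, GeneratesOver 0 m x := by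
  choose π hπ using fun o : orbitRel.Quotient G X => exists_supports_Iio_smul (card_supp_le h o.out)
  refine ⟨fun o => π o • o.out, hπ, fun y => ?_⟩
  let o : orbitRel.Quotient G X := Quotient.mk _ y
  obtain ⟨σ, hσ⟩ : o.out ∈ orbit G y := Quotient.mk_out (s := orbitRel G X) y
  exact ⟨o, (π o * σ)⁻¹, by simp,
    by rw [← hσ, inv_smul_eq_iff, mul_smul]⟩

theorem exists_generatesOver_fin [Nonempty X] {n m : ℕ} (hn : numOrbits X ≤ n)
    (hm : nominalDim X ≤ m) : ∃ x : Fin n → X, GeneratesOver 0 m x := by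
  obtain ⟨x, hx⟩ := exists_generatesOver hm
  have : Finite (orbitRel.Quotient G X) :=
    ENat.card_lt_top.1 (hn.trans_lt (ENat.natCast_lt_top n))
  have hcard : Nat.card (orbitRel.Quotient G X) ≤ n := by
    rw [numOrbits, ENat.card_eq_coe_natCard] at hn
    exact_mod_cast hn
  have : Nonempty (orbitRel.Quotient G X) := .map (Quotient.mk _) ‹_›
  let e : orbitRel.Quotient G X ↪ Fin n :=
    (Finite.equivFin _).toEmbedding.trans (Fin.castLEEmb hcard)
  exact ⟨x ∘ Function.invFun e, hx.comp_surjective (Function.invFun_surjective e.injective)⟩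

/-- The permutation taking a generator to `y` matters only on the least support of the generator,
so it can be chosen to map all atoms below `k` to atoms below `m`. -/
theorem GeneratesOver.exists_extend_smul_eq {k m : ℕ} (hkm : k ≤ m) {x : ι → X}
    (hx : GeneratesOver 0 k x) {y : X} (hy : Supports G (Set.Iio m) y) :
    ∃ i, ∃ f : Fin k ↪ Fin m, extend f • x i = y := by
  obtain ⟨i, π, -, rfl⟩ := hx.exists_smul_eq y
  have hsupp : supp (x i) ⊆ Finset.range k := supp_subset (by simpa using hx.supports i)
  have hsupp' : supp (x i) ⊆ (Finset.range m).image ⇑π⁻¹ :=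
    supp_subset (by simpa using supports_image_smul hy π⁻¹)
  obtain ⟨ε, hε, hmaps⟩ := exists_perm_eqOn_mapsTo (s := supp (x i)) (t := Finset.range k)
    (u := Finset.range m) (f := π) π.injective.injOn
    (fun a ha => by
      obtain ⟨b, hb, rfl⟩ := Finset.mem_image.1 (hsupp' ha)
      simpa using hb)
    (by simpa [Finset.union_eq_right.2 hsupp] using hkm)
  obtain ⟨f, hf⟩ := exists_eqOn_extend (k := k) (m := m) (π := ε) (by simpa using hmaps)
  exact ⟨i, f, (smul_eq_smul_of_supports (hx.supports i) hf).trans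
    (smul_eq_smul_of_supports (supports_supp (x i)) hε)⟩

end Generators

section RegisterAutomata

/-- A register automaton with `k` registers, control states `S` and input symbols `I`. An input
symbol stands for a letter supported by `m` atoms, those below `k` being the contents of the
registers; a transition says which of the `m` atoms is stored in each register. -/
structure RegisterAutomaton (S I : Type*) (k m : ℕ) where
  start : S
  accept : S → Bool
  step : S → I → S × (Fin k ↪ Fin m)

/-- A way to read the letters of `A` as input symbols, where the symbol `i` stands for `letter i`.
If the registers contain `π 0, …, π (k - 1)`, then `b` is read as the symbol `symbol π b`, with
`valuation π b` telling which atoms are meant. -/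
structure Reading {A I : Type*} [MulAction G A] (k : ℕ) (letter : I → A) where
  symbol : G → A → I
  valuation : G → A → G
  valuation_eqOn : ∀ π b, Set.EqOn (valuation π b) π (Set.Iio k)
  valuation_smul_letter : ∀ π b, valuation π b • letter (symbol π b) = b

variable {A Q S I : Type*} [MulAction G A] [MulAction G Q] {k m : ℕ} {letter : I → A}

theorem GeneratesOver.nonempty_reading (h : GeneratesOver k m letter) :
    Nonempty (Reading k letter) := by
  choose symbol θ hθ hletter using h.exists_smul_eq
  exact ⟨{
    symbol := fun π b => symbol (π⁻¹ • b)
    valuation := fun π b => π * θ (π⁻¹ • b)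
    valuation_eqOn := fun π b a ha =>
      congrArg π ((mem_fixingSubgroup_iff G).1 (hθ (π⁻¹ • b)) a ha)
    valuation_smul_letter := fun π b => by rw [mul_smul, hletter, smul_inv_smul] }⟩

namespace RegisterAutomaton

/-- The successor of a configuration `(i, π)`, where `i` is the control state and the register `a`
contains the atom `π a`; the values of `π` at other atoms are irrelevant. -/
noncomputable def next (R : RegisterAutomaton S I k m) (ρ : Reading k letter) (c : S × G) (b : A) :
    S × G :=
  let t := R.step c.1 (ρ.symbol c.2 b)
  (t.1, ρ.valuation c.2 b * extend t.2)

/-- The configuration reached on a word. -/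
noncomputable def run (R : RegisterAutomaton S I k m) (ρ : Reading k letter) (w : List A) : S × G :=
  w.foldl (R.next ρ) (R.start, 1)

/-- The language recognized by a register automaton. -/
noncomputable def language (R : RegisterAutomaton S I k m) (ρ : Reading k letter) (w : List A) :
    Bool :=
  R.accept (R.run ρ w).1

variable [IsNominal Q]

/-- `R` describes the nominal DFA `M` in terms of the states `q i` and the letters `letter j`. -/
structure Presents (R : RegisterAutomaton S I k m) (M : NominalDFA A Q) (letter : I → A)
    (q : S → Q) : Prop where
  supports : ∀ i, Supports G (Set.Iio k) (q i)
  start : q R.start = M.start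
  accept : ∀ i, R.accept i = true ↔ q i ∈ M.accept
  step : ∀ i j, extend (R.step i j).2 • q (R.step i j).1 = M.step (q i) (letter j)

end RegisterAutomaton

variable [IsNominal Q]

theorem NominalDFA.smul_start (M : NominalDFA A Q) (π : G) : π • M.start = M.start := by
  have : π • M.start ∈ orbit G M.start := mem_orbit _ _
  rwa [M.orbit_start] at this

theorem NominalDFA.smul_mem_accept_iff (M : NominalDFA A Q) (π : G) (s : Q) :
    π • s ∈ M.accept ↔ s ∈ M.accept :=
  ⟨fun h => by simpa using M.accept_equivariant π⁻¹ _ h, M.accept_equivariant π s⟩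

theorem NominalDFA.supports_step (M : NominalDFA A Q) {D : Set ℕ} {s : Q} {b : A}
    (hs : Supports G D s) (hb : Supports G D b) : Supports G D (M.step s b) := fun π hπ => by
  rw [← M.step_equivariant, hs π hπ, hb π hπ]

theorem NominalDFA.exists_presents (M : NominalDFA A Q) (hkm : k ≤ m)
    (hletter : ∀ j, Supports G (Set.Iio m) (letter j)) {q : S → Q} (hq : GeneratesOver 0 k q) :
    ∃ R : RegisterAutomaton S I k m, R.Presents M letter q := by
  classical
  obtain ⟨i₀, π, -, hπ⟩ := hq.exists_smul_eq M.start
  have hstart : q i₀ = M.start := by rw [← M.smul_start π⁻¹, ← hπ, inv_smul_smul]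
  have hstep : ∀ i j, Supports G (Set.Iio m) (M.step (q i) (letter j)) := fun i j =>
    M.supports_step ((hq.supports i).mono (Set.Iio_subset_Iio hkm)) (hletter j)
  choose i' f hf using fun i j => hq.exists_extend_smul_eq hkm (hstep i j)
  exact ⟨⟨i₀, fun i => decide (q i ∈ M.accept), fun i j => (i' i j, f i j)⟩,
    hq.supports, hstart, fun i => decide_eq_true_iff, hf⟩

namespace RegisterAutomaton.Presents

variable {R : RegisterAutomaton S I k m} {M : NominalDFA A Q} {q : S → Q}

theorem next_smul (h : R.Presents M letter q) (ρ : Reading k letter) (c : S × G) (b : A) :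
    (R.next ρ c b).2 • q (R.next ρ c b).1 = M.step (c.2 • q c.1) b := by
  set π' := ρ.valuation c.2 b
  have hstate : c.2 • q c.1 = π' • q c.1 :=
    (smul_eq_smul_of_supports (h.supports c.1) (ρ.valuation_eqOn c.2 b)).symm
  calc (R.next ρ c b).2 • q (R.next ρ c b).1
      = π' • M.step (q c.1) (letter (ρ.symbol c.2 b)) := by rw [← h.step, smul_smul]; rfl
    _ = M.step (c.2 • q c.1) b := by
      rw [← M.step_equivariant, ρ.valuation_smul_letter, hstate]

theorem run_smul (h : R.Presents M letter q) (ρ : Reading k letter) (w : List A) :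
    (R.run ρ w).2 • q (R.run ρ w).1 = M.toDFA.eval w := by
  have hfold := List.foldl_hom (fun c : S × G => c.2 • q c.1) (g₁ := R.next ρ) (g₂ := M.step)
    (l := w) (init := (R.start, 1)) fun c b => (h.next_smul ρ c b).symm
  rw [one_smul, h.start] at hfold
  exact hfold.symm

theorem language_eq (h : R.Presents M letter q) (ρ : Reading k letter) {L : List A → Bool}
    (hL : M.Recognizes L) : R.language ρ = L := by
  funext w
  rw [Bool.eq_iff_iff, ← hL w, ← h.run_smul ρ, M.smul_mem_accept_iff, ← h.accept, language]

end RegisterAutomaton.Presents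

end RegisterAutomata

section Counting

theorem two_pow_le_encard_of_shatters {X : Type*} {d : ℕ} {C : Set (X → Bool)}
    {T : BinaryElementTree X d} (h : Shatters C T) : 2 ^ d ≤ C.encard := by
  obtain ⟨leaf, hmem, hleaf⟩ := h
  have hinj : Function.Injective leaf := by
    intro s t hst
    funext i
    induction i using WellFoundedLT.induction with
    | ind i ih =>
      have hnode : (fun j : Fin i => s (Fin.castLE i.isLt.le j)) =
          fun j => t (Fin.castLE i.isLt.le j) := funext fun j => ih _ j.2
      rw [Bool.eq_iff_iff, ← hleaf s i, ← hleaf t i, hst, hnode]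
  calc (2 ^ d : ℕ∞) = (Set.range leaf).encard := by
        simp [← Set.image_univ, hinj.encard_image, ENat.card_eq_coe_fintype_card]
    _ ≤ C.encard := Set.encard_le_encard (Set.range_subset_iff.2 hmem)

theorem exists_littlestoneDim_eq_of_encard_le {X : Type*} {C : Set (X → Bool)} {N : ℕ}
    (hC : C.encard ≤ N) : ∃ d : ℕ, littlestoneDim C = d ∧ d ≤ Real.logb 2 N := by
  have hle : littlestoneDim C ≤ (Nat.log 2 N : ℕ) := by
    refine iSup₂_le fun d ⟨T, hT⟩ => ?_
    have hpow : 2 ^ d ≤ N := by exact_mod_cast (two_pow_le_encard_of_shatters hT).trans hC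
    exact_mod_cast Nat.le_log_of_pow_le one_lt_two hpow
  obtain ⟨d, hd⟩ := ENat.ne_top_iff_exists.1 (ne_top_of_le_ne_top (ENat.natCast_ne_top _) hle)
  rw [← hd, Nat.cast_le] at hle
  exact ⟨d, hd.symm, (Nat.cast_le.2 hle).trans (Real.natLog_le_logb N 2)⟩

def RegisterAutomaton.equivProd (S I : Type*) (k m : ℕ) :
    RegisterAutomaton S I k m ≃ S × (S → Bool) × (S → I → S × (Fin k ↪ Fin m)) where
  toFun R := (R.start, R.accept, R.step)
  invFun t := ⟨t.1, t.2.1, t.2.2⟩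

instance (S I : Type*) [Finite S] [Finite I] (k m : ℕ) : Finite (RegisterAutomaton S I k m) :=
  .of_equiv _ (RegisterAutomaton.equivProd S I k m).symm

theorem card_registerAutomaton (S I : Type*) [Finite S] [Finite I] (k m : ℕ) :
    Nat.card (RegisterAutomaton S I k m) = Nat.card S * (2 ^ Nat.card S *
      (Nat.card S * m.descFactorial k) ^ (Nat.card S * Nat.card I)) := by
  have hemb : Nat.card (Fin k ↪ Fin m) = m.descFactorial k := by
    simp [Nat.card_eq_fintype_card, Fintype.card_embedding_eq]
  rw [Nat.card_congr (RegisterAutomaton.equivProd S I k m)]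
  simp only [Nat.card_prod, Nat.card_fun, hemb, Nat.card_eq_fintype_card (α := Bool),
    Fintype.card_bool, ← pow_mul, mul_comm (Nat.card I)]

theorem encard_nominalLanguages_le {A : Type u} [MulAction G A] [IsNominal A]
    [Finite (orbitRel.Quotient G A)] {p : ℕ} (hp : nominalDim A ≤ p) (n k : ℕ) :
    (nominalLanguages.{u, v} A n k).encard ≤ Nat.card (RegisterAutomaton (Fin n)
      (orbitRel.Quotient G A × (Fin p ↪ Fin (k + p))) k (k + p)) := by
  obtain ⟨a, ha⟩ := exists_generatesOver hp
  have hletter := ha.extend_smul k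
  obtain ⟨ρ⟩ := hletter.nonempty_reading
  have hsub : nominalLanguages.{u, v} A n k ⊆
      Set.range fun R : RegisterAutomaton (Fin n) _ k (k + p) => R.language ρ := by
    rintro L ⟨-, Q, _, _, M, hn, hk, hL⟩
    have : Nonempty Q := ⟨M.start⟩
    obtain ⟨q, hq⟩ := exists_generatesOver_fin hn hk
    obtain ⟨R, hR⟩ := M.exists_presents (Nat.le_add_right k p) hletter.supports hq
    exact ⟨R, hR.language_eq ρ hL⟩
  rw [← ENat.card_eq_coe_natCard, ← Set.encard_univ]
  refine (Set.encard_le_encard hsub).trans ?_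
  rw [← Set.image_univ]
  exact Set.encard_image_le _ _

theorem log_card_registerAutomaton_le (S I : Type*) [Finite S] [Nonempty S] [Finite I] {k m : ℕ}
    (hkm : k ≤ m) : Real.log (Nat.card (RegisterAutomaton S I k m)) ≤
      Real.log (Nat.card S) + Nat.card S * Real.log 2 +
        Nat.card S * Nat.card I * (Real.log (Nat.card S) + k * Real.log m) := by
  have hS : (Nat.card S : ℝ) ≠ 0 := by exact_mod_cast Nat.card_pos.ne'
  have hdesc : (0 : ℝ) < m.descFactorial k := by exact_mod_cast Nat.descFactorial_pos.2 hkm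
  have hdesc_log : Real.log (m.descFactorial k) ≤ k * Real.log m := by
    rw [← Real.log_pow]
    exact Real.log_le_log hdesc (by exact_mod_cast Nat.descFactorial_le_pow m k)
  calc Real.log (Nat.card (RegisterAutomaton S I k m))
      = Real.log (Nat.card S) + Nat.card S * Real.log 2 + Nat.card S * Nat.card I *
          (Real.log (Nat.card S) + Real.log (m.descFactorial k)) := by
        rw [card_registerAutomaton]
        push_cast
        rw [Real.log_mul hS (by positivity), Real.log_mul (by positivity) (by positivity),
          Real.log_pow, Real.log_pow, Real.log_mul hS hdesc.ne']
        push_cast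
        ring
    _ ≤ _ := by gcongr

theorem mul_log_two_le_log_add_mul_log {n k : ℕ} (hn : 1 ≤ n) (hk : 1 ≤ k) (hnk : (n, k) ≠ (1, 1)) :
    k * Real.log 2 ≤ Real.log n + k * Real.log k := by
  obtain rfl | hk2 := hk.eq_or_lt
  · have hn2 : 2 ≤ n := hn.lt_of_ne fun h => hnk (by rw [h])
    simpa using Real.log_le_log two_pos (Nat.ofNat_le_cast.2 hn2)
  · have hlog : Real.log 2 ≤ Real.log k := Real.log_le_log two_pos (Nat.ofNat_le_cast.2 hk2)
    exact (mul_le_mul_of_nonneg_left hlog k.cast_nonneg).trans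
      (le_add_of_nonneg_left (Real.log_natCast_nonneg n))

theorem add_le_one_add_mul {x y : ℝ} (hx : 1 ≤ x) (hy : 0 ≤ y) : x + y ≤ (1 + y) * x := by
  linarith [le_mul_of_one_le_right hy hx]

theorem log_add_mul_log_add_le (p : ℕ) {n k : ℕ} (hn : 1 ≤ n) (hk : 1 ≤ k)
    (hnk : (n, k) ≠ (1, 1)) : Real.log n + k * Real.log (k + p) ≤
      (1 + Real.log (1 + p) / Real.log 2) * (Real.log n + k * Real.log k) := by
  have hk0 : (0 : ℝ) < k := Nat.cast_pos.2 hk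
  have hp : 0 ≤ Real.log (1 + p) := Real.log_nonneg (by simp)
  have hlog : Real.log (k + p) ≤ Real.log (1 + p) + Real.log k := by
    rw [← Real.log_mul (by positivity) hk0.ne']
    exact Real.log_le_log (by positivity) (add_le_one_add_mul (Nat.one_le_cast.2 hk) p.cast_nonneg)
  calc Real.log n + k * Real.log (k + p)
      ≤ Real.log n + k * (Real.log (1 + p) + Real.log k) := by gcongr
    _ = Real.log n + k * Real.log k + Real.log (1 + p) / Real.log 2 * (k * Real.log 2) := by
      field_simp
      ring
    _ ≤ Real.log n + k * Real.log k +
        Real.log (1 + p) / Real.log 2 * (Real.log n + k * Real.log k) := by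
      gcongr
      exact mul_log_two_le_log_add_mul_log hn hk hnk
    _ = _ := by ring

theorem card_prod_embedding_le (J : Type*) (p : ℕ) {k : ℕ} (hk : 1 ≤ k) :
    (Nat.card (J × (Fin p ↪ Fin (k + p))) : ℝ) ≤ Nat.card J * ((1 + p) ^ p * k ^ p) := by
  rw [Nat.card_prod, Nat.card_eq_fintype_card (α := Fin p ↪ _), Fintype.card_embedding_eq,
    Fintype.card_fin, Fintype.card_fin, Nat.cast_mul, ← mul_pow]
  gcongr
  calc ((k + p).descFactorial p : ℝ) ≤ (k + p) ^ p := by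
        exact_mod_cast Nat.descFactorial_le_pow (k + p) p
    _ ≤ ((1 + p) * k) ^ p := by
        gcongr
        exact add_le_one_add_mul (Nat.one_le_cast.2 hk) p.cast_nonneg

theorem exists_logb_card_registerAutomaton_le (J : Type*) [Finite J] (p : ℕ) :
    ∃ C : ℝ, 0 < C ∧ ∀ n k : ℕ, 1 ≤ n → 1 ≤ k → (n, k) ≠ (1, 1) →
      Real.logb 2 (Nat.card (RegisterAutomaton (Fin n) (J × (Fin p ↪ Fin (k + p))) k (k + p))) ≤
        C * (n * k ^ p * (Real.log n + k * Real.log k)) := by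
  have hlog2 : 0 < Real.log 2 := Real.log_pos one_lt_two
  have hlogp : 0 ≤ Real.log (1 + p) := Real.log_nonneg (by simp)
  set B : ℝ := 1 + Real.log (1 + p) / Real.log 2
  refine ⟨(2 + Nat.card J * (1 + p) ^ p * B) / Real.log 2, by positivity, fun n k hn hk hnk => ?_⟩
  have : NeZero n := ⟨Nat.one_le_iff_ne_zero.1 hn⟩
  have hn1 : (1 : ℝ) ≤ n := Nat.one_le_cast.2 hn
  have hk1 : (1 : ℝ) ≤ k := Nat.one_le_cast.2 hk
  set X : ℝ := Real.log n + k * Real.log k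
  have hkX : k * Real.log 2 ≤ X := mul_log_two_le_log_add_mul_log hn hk hnk
  have hX : Real.log 2 ≤ X := (le_mul_of_one_le_left hlog2.le hk1).trans hkX
  have hnX : Real.log n ≤ X :=
    le_add_of_nonneg_right (mul_nonneg k.cast_nonneg (Real.log_natCast_nonneg k))
  have hkp : (1 : ℝ) ≤ k ^ p := one_le_pow₀ hk1
  have hcard := log_card_registerAutomaton_le (Fin n) (J × (Fin p ↪ Fin (k + p)))
    (Nat.le_add_right k p)
  rw [Nat.card_fin, Nat.cast_add] at hcard
  have hnonneg : 0 ≤ Real.log n + k * Real.log (k + p) :=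
    add_nonneg (Real.log_natCast_nonneg n)
      (mul_nonneg k.cast_nonneg (by exact_mod_cast Real.log_natCast_nonneg (k + p)))
  rw [Real.logb, div_mul_eq_mul_div, div_le_div_iff_of_pos_right hlog2]
  calc _ ≤ _ := hcard
    _ ≤ X + n * X + n * (Nat.card J * ((1 + p) ^ p * k ^ p)) * (B * X) := by
      gcongr
      · exact card_prod_embedding_le J p hk
      · exact log_add_mul_log_add_le p hn hk hnk
    _ ≤ n * k ^ p * X + n * k ^ p * X + n * (Nat.card J * ((1 + p) ^ p * k ^ p)) * (B * X) := by
      have hX0 : 0 ≤ X := hlog2.le.trans hX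
      gcongr
      · exact le_mul_of_one_le_left hX0 (one_le_mul_of_one_le_of_one_le hn1 hkp)
      · exact le_mul_of_one_le_right n.cast_nonneg hkp
    _ = (2 + Nat.card J * (1 + p) ^ p * B) * (n * k ^ p * X) := by ring

end Counting

end Nominal

theorem mainTheorem4 (A : Type u) [MulAction Nominal.G A] [Nominal.IsNominal A]
    (hA : Nominal.OrbitFinite A) (p : ℕ) (hp : Nominal.nominalDim A = (p : ℕ∞)) :
    ∃ C : ℝ, 0 < C ∧ ∀ n k : ℕ, 1 ≤ n → 1 ≤ k → (n, k) ≠ (1, 1) →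
      ∃ d : ℕ, Nominal.littlestoneDim (Nominal.nominalLanguages.{u, v} A n k) = (d : ℕ∞) ∧
        (d : ℝ) ≤ C * ((n : ℝ) * (k : ℝ) ^ p * (Real.log n + k * Real.log k)) := by
  have : Finite (MulAction.orbitRel.Quotient Nominal.G A) := hA
  obtain ⟨C, hC, hbound⟩ := Nominal.exists_logb_card_registerAutomaton_le
    (MulAction.orbitRel.Quotient Nominal.G A) p
  refine ⟨C, hC, fun n k hn hk hnk => ?_⟩
  obtain ⟨d, hd, hle⟩ := Nominal.exists_littlestoneDim_eq_of_encard_le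
    (Nominal.encard_nominalLanguages_le.{u, v} hp.le n k)
  exact ⟨d, hd, hle.trans (hbound n k hn hk hnk)⟩
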